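/- Let $R$ be a commutative noetherian local ring with maximal ideal $\mathfrak m$ and depth $d$. Let $\boldsymbol x = x_1,\dots,x_n$ ($n\ge 0$) be an $R$-regular sequence in $\mathfrak m$ such that $\mathfrak m$ is quasi-decomposable with $\boldsymbol x$, that is, the $R$-module $\mathfrak m/(\boldsymbol x)$ is a direct sum of two nonzero submodules. Let $M$ and $N$ be finitely generated $R$-modules, and suppose that there is an integer $t\ge\max\{5,n+1\}$ such that $\operatorname{Tor}^R_i(M,N)=0$ for all integers $i$ with $t+n\le i\le t+n+d$. Then $\operatorname{pd}_R M<\infty$ or $\operatorname{pd}_R N<\infty$. -/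

import Mathlib

open CategoryTheory

universe u v

/-- A module is decomposable if it is the internal direct sum of two nonzero submodules. -/
def IsDecomposableModule (R : Type u) [CommRing R] (M : Type v) [AddCommGroup M] [Module R M] :
    Prop :=
  ∃ A B : Submodule R M, A ≠ ⊥ ∧ B ≠ ⊥ ∧ IsCompl A B

/-- The ideal `I` is quasi-decomposable with the sequence `xs` if `xs` is an `R`-regular sequence
of elements of `I` (with `R / (xs) ≠ 0`) and the `R`-module `I / (xs)` is decomposable. -/
structure Ideal.IsQuasiDecomposableWith {R : Type u} [CommRing R] (I : Ideal R) (xs : List R) :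
    Prop where
  isRegular : RingTheory.Sequence.IsRegular R xs
  mem : ∀ x ∈ xs, x ∈ I
  isDecomposable : IsDecomposableModule R (I ⧸ Submodule.submoduleOf (Ideal.ofList xs) I)

/-- The depth of a local ring: the supremum of the lengths of the regular sequences in its
maximal ideal. -/
noncomputable def IsLocalRing.depth (R : Type u) [CommRing R] [IsLocalRing R] : ℕ∞ :=
  ⨆ xs ∈ {xs : List R | RingTheory.Sequence.IsRegular R xs ∧
    ∀ x ∈ xs, x ∈ IsLocalRing.maximalIdeal R}, (xs.length : ℕ∞)

/-! ### Minimal covers and minimal syzygies. -/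

section

open IsLocalRing

/-! Lift the two summands of m/(xs) to ideals A, B with A + B = m and A ∩ B = (xs). A syzygy of
index at least n + 2 is the sum of its parts with coordinates in A and in B (`part_sup_part`). Take
syzygies X of M and Y of N. A minimal generator y in the B-part of X and one z in the A-part of Y
would give y ⊗ z an image divisible by (xs), since AB ⊆ (xs). Vanishing of n + 1 consecutive Tor
modules pulls this back to X ⊗ Y, where y ⊗ z is not even in m(X ⊗ Y). So nonzero X and Y lie both
in A or both in B (`part_eq_top_and_or`).

Consecutive nonzero syzygies never have the same type (`not_part_succ_eq_top`), so comparing two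
pairs of indices of equal sum forces opposite types. If d > n, one more Tor module compares a third
pair and gives a contradiction. If d = n, a socle element of R/(xs) does (`false_of_part_eq_top`).
Hence some syzygy of M or N is zero. -/

lemma Ideal.mem_smul_top_pi_iff {R : Type u} [CommRing R] {r : ℕ} (J : Ideal R)
    (x : Fin r → R) :
    x ∈ J • (⊤ : Submodule R (Fin r → R)) ↔ ∀ i, x i ∈ J := by
  constructor
  · intro hx i
    refine Submodule.smul_induction_on (p := fun x => x i ∈ J) hx ?_ ?_
    · intro a ha y _
      exact J.mul_mem_right _ ha
    · intro y z hy hz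
      exact J.add_mem hy hz
  · intro h
    rw [pi_eq_sum_univ x]
    exact Submodule.sum_mem _ fun i _ => Submodule.smul_mem_smul (h i) trivial

theorem IsLocalRing.exists_minimal_cover (R : Type u) [CommRing R] [IsLocalRing R]
    (M : Type v) [AddCommGroup M] [Module R M] [Module.Finite R M] :
    ∃ (r : ℕ) (π : (Fin r → R) →ₗ[R] M), Function.Surjective π ∧
      ∀ x, π x = 0 → ∀ i, x i ∈ maximalIdeal R := by
  let V := M ⧸ (maximalIdeal R • ⊤ : Submodule R M)
  let _ : Field (R ⧸ maximalIdeal R) := Ideal.Quotient.field _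
  have hfin : Module.Finite (R ⧸ maximalIdeal R) V :=
    Module.Finite.of_restrictScalars_finite R _ _
  let b := Module.finBasis (R ⧸ maximalIdeal R) V
  choose m hm using fun i => Submodule.mkQ_surjective (maximalIdeal R • ⊤ : Submodule R M) (b i)
  refine ⟨_, Fintype.linearCombination R m, ?_, ?_⟩
  · rw [← LinearMap.range_eq_top, Fintype.range_linearCombination,
      ← IsLocalRing.map_mkQ_eq_top, Submodule.map_span, ← Set.range_comp]
    have : (Submodule.mkQ (maximalIdeal R • ⊤ : Submodule R M)) ∘ m = b := funext hm
    rw [this]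
    rw [← Submodule.restrictScalars_span R (R ⧸ maximalIdeal R) Ideal.Quotient.mk_surjective,
      b.span_eq, Submodule.restrictScalars_top]
  · intro x hx i
    have h0 := congrArg (Submodule.mkQ (maximalIdeal R • ⊤ : Submodule R M)) hx
    rw [Fintype.linearCombination_apply, map_sum, map_zero] at h0
    have h1 : ∑ i, (Ideal.Quotient.mk (maximalIdeal R) (x i)) • b i = 0 := by
      rw [← h0]
      refine Finset.sum_congr rfl fun i _ => ?_
      rw [map_smul, hm]
      rfl
    exact Ideal.Quotient.eq_zero_iff_mem.mp
      (Fintype.linearIndependent_iff.mp b.linearIndependent _ h1 i)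

/-- A sequence of modules in which every term is the kernel of a minimal cover of the previous
one by a free module. -/
structure MinimalSyzygies (R : Type u) [CommRing R] [IsLocalRing R] where
  X : ℕ → ModuleCat.{u} R
  finite : ∀ j, Module.Finite R (X j)
  rank : ℕ → ℕ
  ι : ∀ j, X (j + 1) →ₗ[R] (Fin (rank j) → R)
  π : ∀ j, (Fin (rank j) → R) →ₗ[R] X j
  injective : ∀ j, Function.Injective (ι j)
  surjective : ∀ j, Function.Surjective (π j)
  exact : ∀ j, Function.Exact (ι j) (π j)
  minimal : ∀ j x i, ι j x i ∈ maximalIdeal R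

attribute [instance] MinimalSyzygies.finite

namespace MinimalSyzygies

variable {R : Type u} [CommRing R] [IsLocalRing R]

theorem exists_zero_eq [IsNoetherianRing R] (M : Type u) [AddCommGroup M] [Module R M]
    [Module.Finite R M] : ∃ C : MinimalSyzygies R, C.X 0 = ModuleCat.of R M := by
  choose r p hs hk using fun M : {M : ModuleCat.{u} R // Module.Finite R M} =>
    haveI := M.2
    IsLocalRing.exists_minimal_cover R M.1
  let Y : ℕ → {M : ModuleCat.{u} R // Module.Finite R M} := fun j =>
    Nat.rec ⟨ModuleCat.of R M, inferInstance⟩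
      (fun _ K => ⟨ModuleCat.of R (LinearMap.ker (p K)), inferInstance⟩) j
  exact ⟨{
    X := fun j => (Y j).1
    finite := fun j => (Y j).2
    rank := fun j => r (Y j)
    ι := fun j => (LinearMap.ker (p (Y j))).subtype
    π := fun j => p (Y j)
    injective := fun j => Submodule.subtype_injective _
    surjective := fun j => hs (Y j)
    exact := fun j => LinearMap.exact_subtype_ker_map (p (Y j))
    minimal := fun j x => hk (Y j) x.1 x.2 }, rfl⟩

variable (C : MinimalSyzygies R)

theorem shortExact (j : ℕ) :
    (ShortComplex.mk (ModuleCat.ofHom (C.ι j)) (ModuleCat.ofHom (C.π j))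
      (by ext x; exact (C.exact j).apply_apply_eq_zero x)).ShortExact :=
  ModuleCat.shortComplex_shortExact _ (C.exact j) (C.injective j) (C.surjective j)

theorem projectiveDimension_lt_top_of_subsingleton (j : ℕ) (h : Subsingleton (C.X j)) :
    projectiveDimension (C.X 0) < ⊤ := by
  suffices ∀ k n, HasProjectiveDimensionLT (C.X k) n → HasProjectiveDimensionLT (C.X 0) (n + k) by
    rw [lt_top_iff_ne_top, projectiveDimension_ne_top_iff]
    have := this j 0 (ModuleCat.isZero_of_subsingleton _).hasProjectiveDimensionLT_zero
    exact ⟨0 + j, hasProjectiveDimensionLT_of_ge _ _ _ (Nat.le_succ _)⟩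
  intro k
  induction k with
  | zero => intro n h; exact h
  | succ k ih =>
    intro n h
    have := ih (n + 1) ((C.shortExact k).hasProjectiveDimensionLT_X₃ n h ?_)
    · rwa [add_right_comm] at this
    · have : Projective (ModuleCat.of R (Fin (C.rank k) → R)) :=
        (IsProjective.iff_projective _).mp inferInstance
      have : HasProjectiveDimensionLT (ModuleCat.of R (Fin (C.rank k) → R)) 1 := inferInstance
      exact hasProjectiveDimensionLT_of_ge _ 1 _ (by omega)

end MinimalSyzygies

end

/-! ### The spliced free resolution and vanishing of Tor. -/

section

open TensorProduct LinearMap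

namespace MinimalSyzygies

variable {R : Type u} [CommRing R] [IsLocalRing R] (C : MinimalSyzygies R)

/-- The complex of free modules obtained by splicing the minimal covers. -/
noncomputable def complex : ChainComplex (ModuleCat.{u} R) ℕ :=
  ChainComplex.of (fun j => ModuleCat.of R (Fin (C.rank j) → R))
    (fun j => ModuleCat.ofHom (C.ι j ∘ₗ C.π (j + 1)))
    (fun j => by
      ext x
      simp [(C.exact (j + 1)).apply_apply_eq_zero])

theorem complex_d (j : ℕ) :
    C.complex.d (j + 1) j = ModuleCat.ofHom (C.ι j ∘ₗ C.π (j + 1)) := by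
  dsimp only [complex]
  exact ChainComplex.of_d _ _ _

theorem complex_exactAt_succ (j : ℕ) : C.complex.ExactAt (j + 1) := by
  rw [HomologicalComplex.exactAt_iff' _ (j + 1 + 1) (j + 1) j (by simp) (by simp),
    ShortComplex.moduleCat_exact_iff]
  intro x hx
  have hx' : C.ι j (C.π (j + 1) x) = 0 := by
    have : C.complex.d (j + 1) j x = 0 := hx
    rwa [complex_d] at this
  obtain ⟨y, hy⟩ := (C.exact (j + 1) x).mp (C.injective j (hx'.trans (map_zero _).symm))
  obtain ⟨z, rfl⟩ := C.surjective (j + 2) y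
  refine ⟨z, ?_⟩
  change C.complex.d (j + 1 + 1) (j + 1) z = x
  rw [complex_d]
  exact hy

/-- The augmentation of the spliced complex. -/
noncomputable def augmentation : C.complex ⟶ (ChainComplex.single₀ (ModuleCat R)).obj (C.X 0) :=
  (ChainComplex.toSingle₀Equiv _ _).symm ⟨ModuleCat.ofHom (C.π 0), by
    rw [complex_d]
    ext x
    exact (C.exact 0).apply_apply_eq_zero _⟩

theorem augmentation_f_zero : C.augmentation.f 0 = ModuleCat.ofHom (C.π 0) :=
  ChainComplex.toSingle₀Equiv_symm_apply_f_zero _ _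

/-- The free resolution of the first term of a sequence of minimal syzygies. -/
noncomputable def projectiveResolution : ProjectiveResolution (C.X 0) where
  complex := C.complex
  projective n := (IsProjective.iff_projective _).mp
    (inferInstanceAs (Module.Projective R (Fin (C.rank n) → R)))
  π := C.augmentation
  quasiIso := ⟨fun n => by
    cases n
    · rw [ChainComplex.quasiIsoAt₀_iff, ShortComplex.quasiIso_iff_of_zeros']
      · constructor
        · rw [ShortComplex.moduleCat_exact_iff]
          intro x hx
          have hx' : C.π 0 x = 0 := by
            change C.augmentation.f 0 x = 0 at hx
            rw [augmentation_f_zero] at hx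
            exact hx
          obtain ⟨y, hy⟩ := (C.exact 0 x).mp hx'
          obtain ⟨z, rfl⟩ := C.surjective 1 y
          refine ⟨z, ?_⟩
          change C.complex.d (0 + 1) 0 z = x
          rw [complex_d]
          exact hy
        · rw [ModuleCat.epi_iff_surjective]
          change Function.Surjective (C.augmentation.f 0)
          rw [augmentation_f_zero]
          exact C.surjective 0
      all_goals rfl
    · rw [quasiIsoAt_iff_exactAt']
      · apply complex_exactAt_succ
      · apply ChainComplex.exactAt_succ_single_obj⟩

theorem lTensor_injective_of_isZero_tor (M : ModuleCat.{u} R) (j : ℕ)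
    (h : Limits.IsZero (((Tor (ModuleCat.{u} R) (j + 1)).obj M).obj (C.X 0))) :
    Function.Injective ((C.ι j).lTensor M) := by
  have h1 := h.of_iso (C.projectiveResolution.isoLeftDerivedObj
    ((MonoidalCategory.tensoringLeft (ModuleCat.{u} R)).obj M) (j + 1)).symm
  have h2 : ((((MonoidalCategory.tensoringLeft (ModuleCat.{u} R)).obj M).mapHomologicalComplex
    _).obj C.complex).ExactAt (j + 1) := by
    rw [HomologicalComplex.exactAt_iff_isZero_homology]
    exact h1
  rw [HomologicalComplex.exactAt_iff' _ (j + 1 + 1) (j + 1) j (by simp) (by simp),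
    ShortComplex.moduleCat_exact_iff] at h2
  have h3 : ∀ x, (C.ι j ∘ₗ C.π (j + 1)).lTensor M x = 0 →
      ∃ y, (C.ι (j + 1) ∘ₗ C.π (j + 2)).lTensor M y = x := by
    have e1 := C.complex_d j
    have e2 := C.complex_d (j + 1)
    intro x hx
    obtain ⟨y, hy⟩ := h2 x (by
      change (MonoidalCategory.whiskerLeft M (C.complex.d (j + 1) j)).hom x = 0
      rw [e1]
      exact hx)
    refine ⟨y, ?_⟩
    change (MonoidalCategory.whiskerLeft M (C.complex.d (j + 1 + 1) (j + 1))).hom y = x at hy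
    rw [e2] at hy
    exact hy
  -- A kernel element lifts to a cycle, hence a boundary, and the cover kills boundaries.
  rw [injective_iff_map_eq_zero]
  intro x hx
  obtain ⟨y, rfl⟩ := lTensor_surjective M (C.surjective (j + 1)) x
  obtain ⟨z, rfl⟩ := h3 y (by rw [lTensor_comp, LinearMap.comp_apply, hx])
  rw [← LinearMap.comp_apply, ← lTensor_comp]
  convert LinearMap.zero_apply (σ₁₂ := RingHom.id R) z
  convert lTensor_zero M
  ext x
  simp [(C.exact (j + 1)).apply_apply_eq_zero]

end MinimalSyzygies

end

/-! ### Balancing Tor and shifting degrees between the variables. -/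

section

open TensorProduct LinearMap

section Balance

variable {R : Type*} [CommRing R] {K F M L G N : Type*}
  [AddCommGroup K] [Module R K] [AddCommGroup F] [Module R F] [AddCommGroup M] [Module R M]
  [AddCommGroup L] [Module R L] [AddCommGroup G] [Module R G] [AddCommGroup N] [Module R N]
  {i : K →ₗ[R] F} {p : F →ₗ[R] M} {j : L →ₗ[R] G} {q : G →ₗ[R] N}

/-- Balancing of the first torsion module: for presentations `K → F → M` and `L → G → N` by flat
modules, `K ⊗ N → F ⊗ N` is injective if `M ⊗ L → M ⊗ G` is. -/
theorem TensorProduct.rTensor_injective_of_lTensor_injective [Module.Flat R F]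
    (hip : Function.Exact i p) (hp : Function.Surjective p) [Module.Flat R G]
    (hi : Function.Injective i) (hjq : Function.Exact j q) (hq : Function.Surjective q)
    (h : Function.Injective (j.lTensor M)) : Function.Injective (i.rTensor N) := by
  rw [injective_iff_map_eq_zero]
  intro x hx
  obtain ⟨y, rfl⟩ := lTensor_surjective K hq x
  have hy : q.lTensor F (i.rTensor G y) = 0 := by
    rw [← hx]
    simp only [← LinearMap.comp_apply, lTensor_comp_rTensor, rTensor_comp_lTensor]
  obtain ⟨z, hz⟩ := (lTensor_exact F hjq hq _).mp hy
  have hz0 : p.rTensor L z = 0 := by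
    apply h
    have : j.lTensor M (p.rTensor L z) = p.rTensor G (j.lTensor F z) := by
      simp only [← LinearMap.comp_apply, lTensor_comp_rTensor, rTensor_comp_lTensor]
    rw [this, hz, map_zero]
    exact (rTensor_exact G hip hp).apply_apply_eq_zero y
  obtain ⟨w, rfl⟩ := (rTensor_exact L hip hp _).mp hz0
  have hy' : y = j.lTensor K w := by
    apply Module.Flat.rTensor_preserves_injective_linearMap i hi
    rw [← hz]
    simp only [← LinearMap.comp_apply, lTensor_comp_rTensor, rTensor_comp_lTensor]
  rw [hy']
  exact (lTensor_exact K hjq hq).apply_apply_eq_zero w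

/-- Dimension shift from the second to the first variable of the first torsion module. -/
theorem TensorProduct.lTensor_injective_of_rTensor_injective [Module.Flat R F]
    (hj : Function.Injective j) (h : Function.Injective (i.rTensor L)) :
    Function.Injective (j.lTensor K) := by
  have h' : Function.Injective (j.lTensor F ∘ₗ i.rTensor L) :=
    (Module.Flat.lTensor_preserves_injective_linearMap j hj).comp h
  rw [lTensor_comp_rTensor, ← rTensor_comp_lTensor] at h'
  exact Function.Injective.of_comp h'

end Balance

namespace MinimalSyzygies

variable {R : Type u} [CommRing R] [IsLocalRing R] (C D : MinimalSyzygies R)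

theorem lTensor_injective_succ {a b : ℕ} (h : Function.Injective ((D.ι (b + 1)).lTensor (C.X a))) :
    Function.Injective ((D.ι b).lTensor (C.X (a + 1))) :=
  lTensor_injective_of_rTensor_injective (D.injective b)
    (rTensor_injective_of_lTensor_injective (C.exact a) (C.surjective a) (C.injective a)
      (D.exact (b + 1)) (D.surjective (b + 1)) h)

theorem lTensor_injective_of_zero {a b c : ℕ} (hc : c = a + b)
    (h : Function.Injective ((D.ι c).lTensor (C.X 0))) :
    Function.Injective ((D.ι b).lTensor (C.X a)) := by
  induction a generalizing b with
  | zero =>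
    rw [zero_add] at hc
    exact hc ▸ h
  | succ a ih =>
    exact lTensor_injective_succ C D (ih (by omega))

end MinimalSyzygies

end

/-! ### Regular sequences on syzygies and their tensor products. -/

section

namespace RingTheory.Sequence.IsWeaklyRegular

open Function

variable {R : Type*} [CommRing R] {A : Type*} {B : Type*} {C : Type*}
  [AddCommGroup A] [Module R A] [AddCommGroup B] [Module R B] [AddCommGroup C] [Module R C]

/-- Regularity on the cokernel keeps the sequence left exact modulo `rs`. -/
theorem mem_smul_top_of_exact {rs : List R} {f : A →ₗ[R] B} {g : B →ₗ[R] C} (hf : Injective f)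
    (hfg : Exact f g) (hg : Surjective g) (hC : IsWeaklyRegular C rs) {x : A}
    (hx : f x ∈ Ideal.ofList rs • (⊤ : Submodule R B)) :
    x ∈ Ideal.ofList rs • (⊤ : Submodule R A) := by
  have h0 : Exact (0 : PUnit →ₗ[R] A) f := (f.exact_zero_iff_injective PUnit).mpr hf
  have h := map_first_exact_on_four_term_right_exact_of_isSMulRegular_last h0 hfg hg hC
  have h1 := (h (Submodule.Quotient.mk x)).mp (by
    rw [Submodule.mapQ_apply]
    exact (Submodule.Quotient.mk_eq_zero _).mpr hx)
  obtain ⟨y, hy⟩ := h1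
  obtain ⟨y, rfl⟩ := Submodule.Quotient.mk_surjective _ y
  rw [Submodule.mapQ_apply, LinearMap.zero_apply] at hy
  exact (Submodule.Quotient.mk_eq_zero _).mp hy.symm

theorem take {rs : List R} (h : IsWeaklyRegular A rs) (k : ℕ) :
    IsWeaklyRegular A (rs.take k) := by
  rw [← List.take_append_drop k rs, isWeaklyRegular_append_iff] at h
  exact h.1

/-- A form of the depth lemma: divide by the first element, which preserves left exactness when it
is regular on `C`, and induct. The last element only needs the embedding into `B`. -/
theorem take_succ_of_exact {rs : List R} {k : ℕ} {f : A →ₗ[R] B} {g : B →ₗ[R] C}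
    (hf : Injective f) (hfg : Exact f g) (hg : Surjective g)
    (hB : IsWeaklyRegular B (rs.take (k + 1))) (hC : IsWeaklyRegular C (rs.take k)) :
    IsWeaklyRegular A (rs.take (k + 1)) := by
  induction rs generalizing k A B C with
  | nil => exact nil R A
  | cons x rs ih =>
    rw [List.take_succ_cons, isWeaklyRegular_cons_iff] at hB ⊢
    refine ⟨hB.1.of_injective f hf, ?_⟩
    cases k with
    | zero => exact nil R _
    | succ k =>
      rw [List.take_succ_cons, isWeaklyRegular_cons_iff] at hC
      have h0 : Exact (0 : PUnit →ₗ[R] A) f := (f.exact_zero_iff_injective PUnit).mpr hf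
      have h1 := QuotSMulTop.map_first_exact_on_four_term_exact_of_isSMulRegular_last h0 hfg hC.1
      refine ih ?_ (QuotSMulTop.map_exact x hfg hg) (QuotSMulTop.map_surjective x hg) hB.2 hC.2
      rw [map_zero] at h1
      exact (LinearMap.exact_zero_iff_injective _ _).mp h1

end RingTheory.Sequence.IsWeaklyRegular

namespace MinimalSyzygies

open RingTheory.Sequence TensorProduct

variable {R : Type u} [CommRing R] [IsLocalRing R] (C D : MinimalSyzygies R) {rs : List R}

theorem isWeaklyRegular_take_X (h : IsWeaklyRegular R rs) (k j : ℕ) :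
    IsWeaklyRegular (C.X (j + k)) (rs.take k) := by
  induction k with
  | zero => exact .nil R _
  | succ k ih =>
    refine IsWeaklyRegular.take_succ_of_exact (C.injective (j + k)) (C.exact _) (C.surjective _)
      ?_ ih
    exact ((TensorProduct.lid R (Fin (C.rank (j + k)) → R)).isWeaklyRegular_congr _).mp
      (h.take _).isWeaklyRegular_rTensor

theorem isWeaklyRegular_X (h : IsWeaklyRegular R rs) {j : ℕ} (hj : rs.length ≤ j) :
    IsWeaklyRegular (C.X j) rs := by
  obtain ⟨k, rfl⟩ := Nat.exists_eq_add_of_le' hj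
  have := C.isWeaklyRegular_take_X h rs.length k
  rwa [List.take_length] at this

/-- Each injectivity makes one tensored cover short exact, which gains one regular element. -/
theorem isWeaklyRegular_tensor_take {M : Type*} [AddCommGroup M] [Module R M]
    (hM : IsWeaklyRegular M rs) {b : ℕ} (k : ℕ)
    (h : ∀ i < k, Function.Injective ((D.ι (b + i)).lTensor M)) :
    IsWeaklyRegular (M ⊗[R] D.X (b + k)) (rs.take k) := by
  induction k with
  | zero => exact .nil R _
  | succ k ih =>
    refine IsWeaklyRegular.take_succ_of_exact (h k (by omega))
      (lTensor_exact M (D.exact _) (D.surjective _)) (LinearMap.lTensor_surjective M (D.surjective _))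
      ?_ (ih fun i hi => h i (by omega))
    exact (hM.take _).isWeaklyRegular_rTensor

theorem mem_smul_top_of_ι {j : ℕ} (h : IsWeaklyRegular R rs) (hj : rs.length ≤ j) {x : C.X (j + 1)}
    (hx : ∀ i, C.ι j x i ∈ Ideal.ofList rs) :
    x ∈ Ideal.ofList rs • (⊤ : Submodule R (C.X (j + 1))) :=
  (C.isWeaklyRegular_X h hj).mem_smul_top_of_exact (C.injective j) (C.exact j) (C.surjective j)
    ((Ideal.mem_smul_top_pi_iff _ _).mpr hx)

/-- The injectivities below `b` make `rs` regular on `C.X a ⊗ D.X b`; the one at `b` gives the short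
exact sequence to reduce modulo `rs`. -/
theorem mem_smul_top_of_lTensor_ι {a b : ℕ} (h : IsWeaklyRegular R rs) (ha : rs.length ≤ a)
    (hb : rs.length ≤ b)
    (hinj : ∀ i ≤ b, b ≤ i + rs.length → Function.Injective ((D.ι i).lTensor (C.X a)))
    {x : C.X a ⊗[R] D.X (b + 1)}
    (hx : (D.ι b).lTensor (C.X a) x ∈
      Ideal.ofList rs • (⊤ : Submodule R (C.X a ⊗[R] (Fin (D.rank b) → R)))) :
    x ∈ Ideal.ofList rs • (⊤ : Submodule R (C.X a ⊗[R] D.X (b + 1))) := by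
  obtain ⟨b, rfl⟩ := Nat.exists_eq_add_of_le' hb
  have := D.isWeaklyRegular_tensor_take (C.isWeaklyRegular_X h ha) rs.length
    fun i hi => hinj (b + i) (by omega) (by omega)
  rw [List.take_length] at this
  exact this.mem_smul_top_of_exact (hinj _ le_rfl (by omega))
    (lTensor_exact _ (D.exact _) (D.surjective _))
    (LinearMap.lTensor_surjective _ (D.surjective _)) hx

end MinimalSyzygies

end

/-! ### Splitting syzygies along the two ideals. -/

section

open RingTheory.Sequence TensorProduct IsLocalRing

section TensorResidue

variable {R : Type*} [CommRing R] [IsLocalRing R] {M : Type*} [AddCommGroup M] [Module R M]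
  {N : Type*} [AddCommGroup N] [Module R N]

theorem IsLocalRing.exists_linearMap_residue_ne_zero {x : M}
    (hx : x ∉ maximalIdeal R • (⊤ : Submodule R M)) :
    ∃ f : M →ₗ[R] R ⧸ maximalIdeal R, f x ≠ 0 := by
  let _ : Field (R ⧸ maximalIdeal R) := Ideal.Quotient.field _
  have h0 : Submodule.mkQ (maximalIdeal R • (⊤ : Submodule R M)) x ≠ 0 := fun h =>
    hx ((Submodule.Quotient.mk_eq_zero _).mp h)
  have h1 := mt (Module.forall_dual_apply_eq_zero_iff (R ⧸ maximalIdeal R) _).mp h0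
  push Not at h1
  obtain ⟨f, hf⟩ := h1
  exact ⟨f.restrictScalars R ∘ₗ Submodule.mkQ _, hf⟩

/-- Functionals to the residue field nonzero at `x` and `y` multiply to one nonzero at `x ⊗ y`. -/
theorem IsLocalRing.tmul_notMem_smul_top {x : M} {y : N}
    (hx : x ∉ maximalIdeal R • (⊤ : Submodule R M))
    (hy : y ∉ maximalIdeal R • (⊤ : Submodule R N)) :
    x ⊗ₜ[R] y ∉ maximalIdeal R • (⊤ : Submodule R (M ⊗[R] N)) := by
  intro h
  obtain ⟨f, hf⟩ := exists_linearMap_residue_ne_zero hx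
  obtain ⟨g, hg⟩ := exists_linearMap_residue_ne_zero hy
  have h1 := Submodule.smul_top_le_comap_smul_top (maximalIdeal R)
    (LinearMap.mul' R (R ⧸ maximalIdeal R) ∘ₗ TensorProduct.map f g) h
  have h2 : maximalIdeal R • (⊤ : Submodule R (R ⧸ maximalIdeal R)) = ⊥ := by
    rw [eq_bot_iff, Submodule.smul_le]
    intro r hr z _
    rw [Algebra.smul_def, Ideal.Quotient.algebraMap_eq, Ideal.Quotient.eq_zero_iff_mem.mpr hr,
      zero_mul]
    exact Submodule.zero_mem _
  rw [h2, Submodule.mem_comap, Submodule.mem_bot] at h1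
  exact (mul_ne_zero hf hg) (by simpa using h1)

end TensorResidue

/-- Two ideals that split the maximal ideal modulo a weakly regular sequence. -/
structure IsSplitting {R : Type u} [CommRing R] [IsLocalRing R] (rs : List R) (A B : Ideal R) :
    Prop where
  regular : IsWeaklyRegular R rs
  sup_eq : A ⊔ B = maximalIdeal R
  inf_eq : A ⊓ B = Ideal.ofList rs
  left_not_le : ¬ A ≤ Ideal.ofList rs
  right_not_le : ¬ B ≤ Ideal.ofList rs

namespace IsSplitting

variable {R : Type u} [CommRing R] [IsLocalRing R] {rs : List R} {A B : Ideal R}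

theorem symm (h : IsSplitting rs A B) : IsSplitting rs B A :=
  ⟨h.regular, sup_comm A B ▸ h.sup_eq, inf_comm A B ▸ h.inf_eq, h.right_not_le, h.left_not_le⟩

theorem le_left (h : IsSplitting rs A B) : Ideal.ofList rs ≤ A := h.inf_eq ▸ inf_le_left

theorem le_right (h : IsSplitting rs A B) : Ideal.ofList rs ≤ B := h.inf_eq ▸ inf_le_right

theorem mem_of_mem (h : IsSplitting rs A B) {x : R} (ha : x ∈ A) (hb : x ∈ B) :
    x ∈ Ideal.ofList rs := h.inf_eq ▸ ⟨ha, hb⟩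

theorem left_le (h : IsSplitting rs A B) : A ≤ maximalIdeal R := h.sup_eq ▸ le_sup_left

theorem le_maximalIdeal (h : IsSplitting rs A B) : Ideal.ofList rs ≤ maximalIdeal R :=
  h.le_left.trans h.left_le

end IsSplitting

namespace MinimalSyzygies

variable {R : Type u} [CommRing R] [IsLocalRing R] (C D : MinimalSyzygies R) {rs : List R}
  {A B : Ideal R} {j k : ℕ}

/-- The elements of a syzygy module whose coordinates lie in a given ideal. -/
def part (J : Ideal R) (j : ℕ) : Submodule R (C.X (j + 1)) :=
  (J • (⊤ : Submodule R (Fin (C.rank j) → R))).comap (C.ι j)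

theorem mem_part_iff {J : Ideal R} {x : C.X (j + 1)} : x ∈ C.part J j ↔ ∀ i, C.ι j x i ∈ J :=
  Ideal.mem_smul_top_pi_iff _ _

theorem mem_smul_top_of_mem_part (h : IsSplitting rs A B) (hj : rs.length ≤ j) {x : C.X (j + 1)}
    (ha : x ∈ C.part A j) (hb : x ∈ C.part B j) :
    x ∈ Ideal.ofList rs • (⊤ : Submodule R (C.X (j + 1))) :=
  C.mem_smul_top_of_ι h.regular hj fun i =>
    h.mem_of_mem (C.mem_part_iff.mp ha i) (C.mem_part_iff.mp hb i)

theorem exists_π_eq {J : Ideal R} {x : C.X j} (hx : x ∈ J • (⊤ : Submodule R (C.X j))) :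
    ∃ w, (∀ i, w i ∈ J) ∧ C.π j w = x := by
  rw [← LinearMap.range_eq_top.mpr (C.surjective j), ← Submodule.map_top,
    ← Submodule.map_smul''] at hx
  obtain ⟨w, hw, rfl⟩ := hx
  exact ⟨w, (Ideal.mem_smul_top_pi_iff _ _).mp hw, rfl⟩

theorem part_sup_part (h : IsSplitting rs A B) (hj : rs.length + 1 ≤ j) :
    C.part A j ⊔ C.part B j = ⊤ := by
  obtain ⟨j, rfl⟩ : ∃ k, j = k + 1 := ⟨j - 1, by omega⟩
  rw [eq_top_iff]
  intro x _
  have hx : ∀ i, ∃ a ∈ A, ∃ b ∈ B, a + b = C.ι (j + 1) x i := fun i =>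
    Submodule.mem_sup.mp (h.sup_eq ▸ C.minimal (j + 1) x i)
  choose a ha b hb hab using hx
  have hab' : a + b = C.ι (j + 1) x := funext hab
  -- This element lies in both parts, hence in `(rs)` times the syzygy; correcting `a` by a vector
  -- with coordinates in `(rs)` makes it a syzygy itself.
  have hπ : C.π (j + 1) a = - C.π (j + 1) b := by
    rw [eq_neg_iff_add_eq_zero, ← map_add, hab']
    exact (C.exact (j + 1)).apply_apply_eq_zero x
  have h1 : C.π (j + 1) a ∈ C.part A j :=
    Submodule.smul_top_le_comap_smul_top A (C.ι j ∘ₗ C.π (j + 1))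
      ((Ideal.mem_smul_top_pi_iff _ _).mpr ha)
  have h2 : C.π (j + 1) a ∈ C.part B j := by
    rw [hπ]
    exact Submodule.neg_mem _ (Submodule.smul_top_le_comap_smul_top B (C.ι j ∘ₗ C.π (j + 1))
      ((Ideal.mem_smul_top_pi_iff _ _).mpr hb))
  obtain ⟨w, hw, hwa⟩ := C.exists_π_eq (C.mem_smul_top_of_mem_part h (by omega) h1 h2)
  obtain ⟨y, hy⟩ := (C.exact (j + 1) (a - w)).mp (by rw [map_sub, hwa, sub_self])
  refine Submodule.mem_sup.mpr ⟨y, C.mem_part_iff.mpr fun i => ?_, x - y,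
    C.mem_part_iff.mpr fun i => ?_, add_sub_cancel _ _⟩
  · rw [hy]
    exact A.sub_mem (ha i) (h.le_left (hw i))
  · rw [map_sub, hy, ← hab']
    have : (a + b - (a - w)) i = b i + w i := by
      simp only [Pi.sub_apply, Pi.add_apply]; ring
    rw [this]
    exact B.add_mem (hb i) (h.le_right (hw i))

/-- Otherwise Nakayama makes the `A`-part everything. -/
theorem exists_notMem_of_part_ne_top (h : IsSplitting rs A B) (hj : rs.length + 1 ≤ j)
    (hA : C.part A j ≠ ⊤) :
    ∃ x ∈ C.part B j, x ∉ maximalIdeal R • (⊤ : Submodule R (C.X (j + 1))) := by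
  by_contra! hB
  refine hA (eq_top_iff.mpr ?_)
  refine Submodule.le_of_le_smul_of_le_jacobson_bot Module.Finite.fg_top
    (IsLocalRing.maximalIdeal_le_jacobson ⊥) ?_
  refine (C.part_sup_part h hj).ge.trans ?_
  exact sup_le_sup_left (show C.part B j ≤ _ from hB) _

theorem subsingleton_of_part_eq_top (h : IsSplitting rs A B) (hj : rs.length ≤ j)
    (hA : C.part A j = ⊤) (hB : C.part B j = ⊤) : Subsingleton (C.X (j + 1)) := by
  rw [← Submodule.subsingleton_iff R, ← subsingleton_iff_bot_eq_top, eq_comm]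
  refine Submodule.eq_bot_of_le_smul_of_le_jacobson_bot (maximalIdeal R) ⊤ Module.Finite.fg_top
    (fun x _ => ?_) (IsLocalRing.maximalIdeal_le_jacobson ⊥)
  exact Submodule.smul_mono_left h.le_maximalIdeal
    (C.mem_smul_top_of_mem_part h hj (hA ▸ trivial) (hB ▸ trivial))

theorem part_eq_top_or_part_eq_top (h : IsSplitting rs A B) (hj : rs.length + 1 ≤ j)
    (hk : rs.length + 1 ≤ k)
    (hinj : ∀ i ≤ k, k ≤ i + rs.length → Function.Injective ((D.ι i).lTensor (C.X (j + 1)))) :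
    C.part A j = ⊤ ∨ D.part B k = ⊤ := by
  by_contra! hne
  obtain ⟨y, hyB, hy⟩ := C.exists_notMem_of_part_ne_top h hj hne.1
  obtain ⟨z, hzA, hz⟩ := D.exists_notMem_of_part_ne_top h.symm hk hne.2
  refine tmul_notMem_smul_top hy hz (Submodule.smul_mono_left h.le_maximalIdeal
    (C.mem_smul_top_of_lTensor_ι D h.regular (by omega) (by omega) hinj ?_))
  rw [LinearMap.lTensor_tmul, pi_eq_sum_univ (D.ι k z), tmul_sum]
  refine Submodule.sum_mem _ fun i _ => ?_
  -- The coordinate of `z`, in `A`, moves onto `y`, whose coordinates are in `B`.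
  rw [← smul_tmul]
  refine Submodule.smul_top_le_comap_smul_top _ ((TensorProduct.mk R _ _).flip _)
    (C.mem_smul_top_of_mem_part h (by omega) (C.mem_part_iff.mpr fun l => ?_)
      (Submodule.smul_mem _ _ hyB))
  rw [map_smul]
  exact A.mul_mem_right _ (D.mem_part_iff.mp hzA i)

theorem part_eq_top_and_or (h : IsSplitting rs A B) (hj : rs.length + 1 ≤ j)
    (hk : rs.length + 1 ≤ k)
    (hinj : ∀ i ≤ k, k ≤ i + rs.length → Function.Injective ((D.ι i).lTensor (C.X (j + 1))))
    (hC : ¬ Subsingleton (C.X (j + 1))) (hD : ¬ Subsingleton (D.X (k + 1))) :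
    C.part A j = ⊤ ∧ D.part A k = ⊤ ∨ C.part B j = ⊤ ∧ D.part B k = ⊤ := by
  have h1 := C.part_eq_top_or_part_eq_top D h hj hk hinj
  have h2 := C.part_eq_top_or_part_eq_top D h.symm hj hk hinj
  have h3 : ¬ (C.part A j = ⊤ ∧ C.part B j = ⊤) := fun h' =>
    hC (C.subsingleton_of_part_eq_top h (by omega) h'.1 h'.2)
  have h4 : ¬ (D.part A k = ⊤ ∧ D.part B k = ⊤) := fun h' =>
    hD (D.subsingleton_of_part_eq_top h (by omega) h'.1 h'.2)
  tauto

/-- Multiplying a generator of the syzygy by `c` lands in `(rs)` times the syzygy, so up to a vector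
over `(rs)` the vector `c • e_i` is a relation. Its coordinates lie in `J`. -/
theorem mem_of_part_eq_top (h : IsSplitting rs A B) (hj : rs.length ≤ j)
    (hC : ¬ Subsingleton (C.X (j + 1))) (hA : C.part A j = ⊤) {J : Ideal R}
    (hJ : Ideal.ofList rs ≤ J) (hCJ : C.part J (j + 1) = ⊤) {c : R}
    (hc : ∀ a ∈ A, c * a ∈ Ideal.ofList rs) : c ∈ J := by
  have : Nonempty (Fin (C.rank (j + 1))) := by
    by_contra! hempty
    exact hC (C.surjective (j + 1)).subsingleton
  obtain ⟨i⟩ := this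
  have h1 : c • C.π (j + 1) (Pi.single i 1) ∈
      Ideal.ofList rs • (⊤ : Submodule R (C.X (j + 1))) := by
    refine C.mem_smul_top_of_ι h.regular hj fun l => ?_
    rw [map_smul]
    exact hc _ (C.mem_part_iff.mp (hA ▸ trivial) l)
  obtain ⟨w, hw, hwc⟩ := C.exists_π_eq h1
  obtain ⟨v, hv⟩ := (C.exact (j + 1) (c • Pi.single i 1 - w)).mp
    (by rw [map_sub, map_smul, hwc, sub_self])
  have hvJ : C.ι (j + 1) v i ∈ J := C.mem_part_iff.mp (hCJ ▸ trivial) i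
  rw [hv] at hvJ
  have : c = (c • Pi.single i 1 - w : Fin (C.rank (j + 1)) → R) i + w i := by simp
  rw [this]
  exact J.add_mem hvJ (hJ (hw i))

/-- Since `B` kills `A` modulo `(rs)`, two consecutive syzygies in `A` would force `B ≤ A`. -/
theorem not_part_succ_eq_top (h : IsSplitting rs A B) (hj : rs.length ≤ j)
    (hC : ¬ Subsingleton (C.X (j + 1))) (hA : C.part A j = ⊤) : C.part A (j + 1) ≠ ⊤ := by
  intro hA'
  refine h.right_not_le fun b hb => h.mem_of_mem ?_ hb
  exact C.mem_of_part_eq_top h hj hC hA h.le_left hA' fun a ha =>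
    h.mem_of_mem (A.mul_mem_left _ ha) (B.mul_mem_right _ hb)

theorem false_of_part_eq_top (h : IsSplitting rs A B) (hj : rs.length ≤ j) (hk : rs.length ≤ k)
    (hC : ¬ Subsingleton (C.X (j + 1))) (hD : ¬ Subsingleton (D.X (k + 1)))
    (hCA : C.part A j = ⊤) (hCB : C.part B (j + 1) = ⊤)
    (hDB : D.part B k = ⊤) (hDA : D.part A (k + 1) = ⊤) {z : R} (hz : z ∉ Ideal.ofList rs)
    (hmz : ∀ r ∈ maximalIdeal R, z * r ∈ Ideal.ofList rs) : False := by
  have hzm : z ∈ A ⊔ B := by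
    rw [h.sup_eq]
    by_contra hzu
    obtain ⟨u, rfl⟩ : IsUnit z := by simpa using hzu
    refine h.left_not_le fun a ha => ?_
    have := (Ideal.ofList rs).mul_mem_left (↑u⁻¹ : R) (hmz a (h.left_le ha))
    rwa [← mul_assoc, Units.inv_mul, one_mul] at this
  -- Modulo `(rs)`, `a` kills `A` because `z` and `b` do, and `b` kills `B` likewise. The syzygies
  -- of `C` then put `a` in `B`, and those of `D` put `b` in `A`.
  obtain ⟨a, ha, b, hb, rfl⟩ := Submodule.mem_sup.mp hzm
  refine hz ((Ideal.ofList rs).add_mem (h.mem_of_mem ha ?_) (h.mem_of_mem ?_ hb))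
  · refine C.mem_of_part_eq_top h hj hC hCA h.le_right hCB fun r hr => ?_
    have h1 := hmz r (h.left_le hr)
    rw [add_mul] at h1
    exact ((Ideal.ofList rs).add_mem_iff_left
      (h.mem_of_mem (A.mul_mem_left _ hr) (B.mul_mem_right _ hb))).mp h1
  · refine D.mem_of_part_eq_top h.symm hk hD hDB h.le_left hDA fun r hr => ?_
    have h1 := hmz r (h.symm.left_le hr)
    rw [add_mul] at h1
    exact ((Ideal.ofList rs).add_mem_iff_right
      (h.mem_of_mem (A.mul_mem_right _ ha) (B.mul_mem_left _ hr))).mp h1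

theorem exists_subsingleton (h : IsSplitting rs A B) {t d : ℕ} (ht : 5 ≤ t)
    (hd : rs.length + 1 ≤ d ∨ rs.length ≤ d ∧
      ∃ z ∉ Ideal.ofList rs, ∀ r ∈ maximalIdeal R, z * r ∈ Ideal.ofList rs)
    (hinj : ∀ i, t + rs.length ≤ i + 1 → i + 1 ≤ t + rs.length + d →
      Function.Injective ((D.ι i).lTensor (C.X 0))) :
    (∃ j, Subsingleton (C.X j)) ∨ ∃ j, Subsingleton (D.X j) := by
  by_contra! hne
  simp only [← not_subsingleton_iff_nontrivial] at hne
  obtain ⟨hC, hD⟩ := hne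
  obtain ⟨s, rfl⟩ := Nat.exists_eq_add_of_le' ht
  set n := rs.length with hn
  have hdn : n ≤ d := by omega
  -- The pair `(j, k)` uses Tor in degrees `j + k + 2 - n` to `j + k + 2`. With `t = s + 5`, both
  -- pairs below use exactly `t + n` to `t + 2n`.
  have h1 := C.part_eq_top_and_or D (j := n + 1) (k := n + s + 2) h le_rfl (by omega)
    (fun i hi hi' => C.lTensor_injective_of_zero D rfl (hinj _ (by omega) (by omega)))
    (hC _) (hD _)
  have h2 := C.part_eq_top_and_or D (j := n + 2) (k := n + s + 1) h (by omega) (by omega)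
    (fun i hi hi' => C.lTensor_injective_of_zero D rfl (hinj _ (by omega) (by omega)))
    (hC _) (hD _)
  have h3 := C.not_part_succ_eq_top (j := n + 1) h (by omega) (hC _)
  have h4 := C.not_part_succ_eq_top (j := n + 1) h.symm (by omega) (hC _)
  rcases hd with hd | ⟨-, z, hz, hmz⟩
  -- This pair reaches degree `t + 2n + 1`, available because `n + 1 ≤ d`.
  · have h7 := C.part_eq_top_and_or D (j := n + 2) (k := n + s + 2) h (by omega) (by omega)
      (fun i hi hi' => C.lTensor_injective_of_zero D rfl (hinj _ (by omega) (by omega)))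
      (hC _) (hD _)
    have h8 : ¬ (C.part A (n + 2) = ⊤ ∧ C.part B (n + 2) = ⊤) := fun h' =>
      hC _ (C.subsingleton_of_part_eq_top h (by omega) h'.1 h'.2)
    have h9 : ¬ (D.part A (n + s + 2) = ⊤ ∧ D.part B (n + s + 2) = ⊤) := fun h' =>
      hD _ (D.subsingleton_of_part_eq_top h (by omega) h'.1 h'.2)
    rcases h1 with h1 | h1 <;> rcases h2 with h2 | h2
    · exact h3 h1.1 h2.1
    · exact h7.elim (fun h' => h8 ⟨h'.1, h2.1⟩) (fun h' => h9 ⟨h1.2, h'.2⟩)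
    · exact h7.elim (fun h' => h9 ⟨h'.2, h1.2⟩) (fun h' => h8 ⟨h2.1, h'.1⟩)
    · exact h4 h1.1 h2.1
  · have h7 := C.false_of_part_eq_top D (j := n + 1) (k := n + s + 1) h (by omega) (by omega)
      (hC _) (hD _)
    have h8 := C.false_of_part_eq_top D (j := n + 1) (k := n + s + 1) h.symm (by omega) (by omega)
      (hC _) (hD _)
    rcases h1 with h1 | h1 <;> rcases h2 with h2 | h2
    · exact h3 h1.1 h2.1
    · exact h7 h1.1 h2.1 h2.2 h1.2 hz hmz
    · exact h8 h1.1 h2.1 h2.2 h1.2 hz hmz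
    · exact h4 h1.1 h2.1

end MinimalSyzygies

end

/-! ### Lifting the decomposition, socle elements in the case of depth `n`, and the conclusion. -/

section

open RingTheory.Sequence IsLocalRing

theorem Ideal.IsQuasiDecomposableWith.exists_isSplitting {R : Type u} [CommRing R] [IsLocalRing R]
    {rs : List R} (h : (maximalIdeal R).IsQuasiDecomposableWith rs) :
    ∃ A B : Ideal R, IsSplitting rs A B := by
  obtain ⟨A', B', hA, hB, hAB⟩ := h.isDecomposable
  have hle : Ideal.ofList rs ≤ maximalIdeal R := Ideal.span_le.mpr h.mem
  let K := Submodule.submoduleOf (Ideal.ofList rs) (maximalIdeal R)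
  have hmap : K.map (maximalIdeal R).subtype = Ideal.ofList rs := by
    dsimp only [K]
    rw [Submodule.submoduleOf, Submodule.map_comap_subtype, inf_eq_right.mpr hle]
  have hinj : Function.Injective (maximalIdeal R).subtype := Submodule.subtype_injective _
  have hnot : ∀ S : Submodule R (maximalIdeal R ⧸ K), S ≠ ⊥ →
      ¬ (S.comap K.mkQ).map (maximalIdeal R).subtype ≤ Ideal.ofList rs := by
    intro S hS hle'
    rw [← hmap, Submodule.map_le_map_iff_of_injective hinj] at hle'
    apply hS
    rw [eq_bot_iff, ← Submodule.map_comap_eq_of_surjective K.mkQ_surjective S]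
    exact (Submodule.map_mono hle').trans (Submodule.mkQ_map_self K).le
  refine ⟨(A'.comap K.mkQ).map (maximalIdeal R).subtype,
    (B'.comap K.mkQ).map (maximalIdeal R).subtype,
    ⟨h.isRegular.toIsWeaklyRegular, ?_, ?_, hnot A' hA, hnot B' hB⟩⟩
  · have htop : A'.comap K.mkQ ⊔ B'.comap K.mkQ = ⊤ := by
      rw [eq_top_iff]
      intro x _
      obtain ⟨a, ha, b, hb, hab⟩ := Submodule.mem_sup.mp
        (hAB.sup_eq_top ▸ trivial : K.mkQ x ∈ A' ⊔ B')
      obtain ⟨y, rfl⟩ := K.mkQ_surjective a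
      refine Submodule.mem_sup.mpr ⟨y, ha, x - y, ?_, add_sub_cancel _ _⟩
      rwa [Submodule.mem_comap, map_sub, ← hab, add_sub_cancel_left]
    rw [← Submodule.map_sup, htop, Submodule.map_subtype_top]
  · rw [← Submodule.map_inf _ hinj, ← Submodule.comap_inf, hAB.inf_eq_bot, Submodule.comap_bot,
      Submodule.ker_mkQ, hmap]

theorem IsLocalRing.length_le_depth {R : Type u} [CommRing R] [IsLocalRing R] {rs : List R}
    (h : IsRegular R rs) (hmem : ∀ x ∈ rs, x ∈ maximalIdeal R) :
    (rs.length : ℕ∞) ≤ depth R :=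
  le_iSup₂_of_le (f := fun (xs : List R) (_ : xs ∈ {xs : List R | IsRegular R xs ∧
    ∀ x ∈ xs, x ∈ maximalIdeal R}) => (xs.length : ℕ∞)) rs ⟨h, hmem⟩ le_rfl

/-- The sequence cannot be extended, so the maximal ideal consists of zero divisors on `R / (rs)`;
prime avoidance puts it inside an associated prime, the annihilator of the class of `z`. -/
theorem IsLocalRing.exists_socle_of_depth_eq_length {R : Type u} [CommRing R] [IsNoetherianRing R]
    [IsLocalRing R] {rs : List R} (h : IsRegular R rs) (hmem : ∀ x ∈ rs, x ∈ maximalIdeal R)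
    (hd : depth R = rs.length) :
    ∃ z ∉ Ideal.ofList rs, ∀ r ∈ maximalIdeal R, z * r ∈ Ideal.ofList rs := by
  have hle : Ideal.ofList rs ≤ maximalIdeal R := Ideal.span_le.mpr hmem
  let Q := R ⧸ Ideal.ofList rs
  have hreg : ∀ y ∈ maximalIdeal R, ¬ IsSMulRegular Q y := by
    intro y hy hyreg
    have hw : IsWeaklyRegular R (rs ++ [y]) := by
      rw [isWeaklyRegular_append_iff, isWeaklyRegular_singleton_iff, smul_eq_mul, Ideal.mul_top]
      exact ⟨h.toIsWeaklyRegular, hyreg⟩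
    have hmem' : ∀ x ∈ rs ++ [y], x ∈ maximalIdeal R := by
      intro x hx
      rcases List.mem_append.mp hx with hx | hx
      · exact hmem x hx
      · rwa [List.mem_singleton.mp hx]
    have hr := (isRegular_iff_isWeaklyRegular_of_subset_maximalIdeal hmem').mpr hw
    have := length_le_depth hr hmem'
    rw [hd, List.length_append, List.length_singleton, Nat.cast_le] at this
    omega
  have hsub : (maximalIdeal R : Set R) ⊆ ⋃ p ∈ associatedPrimes R Q, (p : Set R) := by
    rw [biUnion_associatedPrimes_eq_compl_regular]
    exact hreg
  obtain ⟨p, hp, hmp⟩ := (Ideal.subset_union_prime_finite (associatedPrimes.finite R Q)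
    (f := id) 0 0 fun p hp _ _ => IsAssociatedPrime.isPrime hp).mp hsub
  obtain ⟨hprime, x, rfl⟩ := isAssociatedPrime_iff.mp hp
  obtain ⟨z, rfl⟩ := Ideal.Quotient.mk_surjective x
  refine ⟨z, fun hz => hprime.ne_top ?_, fun r hr => ?_⟩
  · rw [Ideal.Quotient.eq_zero_iff_mem.mpr hz, Ideal.eq_top_iff_one, Submodule.mem_colon_singleton,
      smul_zero]
    exact Submodule.zero_mem _
  · have := Submodule.mem_colon_singleton.mp (hmp hr)
    rw [Submodule.mem_bot, Algebra.smul_def, Ideal.Quotient.algebraMap_eq, ← map_mul,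
      Ideal.Quotient.eq_zero_iff_mem] at this
    rwa [mul_comm]

end

theorem mainTheorem7 (R : Type u) [CommRing R] [IsNoetherianRing R] [IsLocalRing R]
    (d n : ℕ) (hd : IsLocalRing.depth R = (d : ℕ∞))
    (xs : List R) (hn : xs.length = n)
    (hxs : (IsLocalRing.maximalIdeal R).IsQuasiDecomposableWith xs)
    (M : Type u) [AddCommGroup M] [Module R M] [Module.Finite R M]
    (N : Type u) [AddCommGroup N] [Module R N] [Module.Finite R N]
    (hTor : ∃ t : ℕ, max 5 (n + 1) ≤ t ∧ ∀ i : ℕ, t + n ≤ i → i ≤ t + n + d →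
      Limits.IsZero (((Tor (ModuleCat.{u} R) i).obj (ModuleCat.of R M)).obj (ModuleCat.of R N))) :
    projectiveDimension (ModuleCat.of R M) < ⊤ ∨
      projectiveDimension (ModuleCat.of R N) < ⊤ := by
  subst hn
  obtain ⟨t, ht, hTor⟩ := hTor
  obtain ⟨A, B, hAB⟩ := hxs.exists_isSplitting
  obtain ⟨C, hC⟩ := MinimalSyzygies.exists_zero_eq (R := R) M
  obtain ⟨D, hD⟩ := MinimalSyzygies.exists_zero_eq (R := R) N
  rw [← hC, ← hD] at hTor ⊢
  have hle := IsLocalRing.length_le_depth hxs.isRegular hxs.mem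
  rw [hd, Nat.cast_le] at hle
  have hd' : xs.length + 1 ≤ d ∨ xs.length ≤ d ∧ ∃ z ∉ Ideal.ofList xs,
      ∀ r ∈ IsLocalRing.maximalIdeal R, z * r ∈ Ideal.ofList xs := by
    rcases hle.lt_or_eq with h | h
    · exact .inl h
    · exact .inr ⟨hle, IsLocalRing.exists_socle_of_depth_eq_length hxs.isRegular hxs.mem
        (by rw [hd, h])⟩
  refine (C.exists_subsingleton D hAB (le_of_max_le_left ht) hd' fun i hi hi' =>
    D.lTensor_injective_of_isZero_tor (C.X 0) i (hTor _ hi hi')).imp ?_ ?_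
  · rintro ⟨j, hj⟩
    exact C.projectiveDimension_lt_top_of_subsingleton j hj
  · rintro ⟨j, hj⟩
    exact D.projectiveDimension_lt_top_of_subsingleton j hj
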